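/- Let $s\ge 0$ and $n\ge 1$ be integers and let $A$ be an alphabet with $s$ letters. For an $n\times n$ tableau $T=(a_{i}^{j})$ with entries in $A$ ($a_i^j$ being the entry in row $i$ and column $j$), let $L$ be the set of its row-words $a_i^1a_i^2\cdots a_i^n$, $1\le i\le n$, and let $$\mathrm{Perm}(T)=\{a_{\pi(1)}^1a_{\pi(2)}^2\cdots a_{\pi(n)}^n : \pi\in S_n\}.$$ The tableau $T$ is called Cantorian if $\mathrm{Perm}(T)\cap L=\emptyset$. Then the number $C(n,s)$ of $n\times n$ Cantorian tableaux with entries in $A$ is given, for $n=2,3,4$, by $$C(2,s)=s^2(s-1)^2,$$ $$C(3,s)=s^3(s-1)^2(s^4+2s^3-15s^2+16s-1),$$ $$C(4,s)=s^4(s-1)^2(s^{10}+2s^9+3s^8-92s^7-43s^6+1014s^5-449s^4-5680s^3+12045s^2-9406s+2629).$$ -/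

import Mathlib

/-- An `n × n` tableau over the alphabet `A`; the entry in row `i` and column `j` is `T i j`. -/
abbrev Tableau (n : ℕ) (A : Type*) : Type _ := Matrix (Fin n) (Fin n) A

namespace Tableau

variable {n : ℕ} {A : Type*}

/-- The set of row-words of `T`; words of length `n` are functions `Fin n → A`. -/
def rowWords (T : Tableau n A) : Set (Fin n → A) :=
  {w | ∃ i : Fin n, w = fun j => T i j}

/-- The permanent of `T`: the set of diagonal words
`T (π 1) 1, T (π 2) 2, …, T (π n) n`, for all permutations `π` of the rows. -/
def permanent (T : Tableau n A) : Set (Fin n → A) :=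
  ⋃ π : Equiv.Perm (Fin n), {fun j => T (π j) j}

/-- A tableau is Cantorian if no row-word belongs to its permanent. -/
def IsCantorian (T : Tableau n A) : Prop :=
  T.permanent ∩ T.rowWords = ∅

end Tableau

/-- The number of `n × n` Cantorian tableaux on an alphabet of `s` letters. -/
noncomputable def cantorianCount (n s : ℕ) : ℕ :=
  {T : Tableau n (Fin s) | T.IsCantorian}.ncard

/-! The count is a transfer-matrix computation. Reading a tableau column by column, keep the states
`(i, U)` such that the part of row-word `i` read so far is spelled by distinct rows forming exactly
`U`; the tableau is Cantorian iff no state is left after `n` columns (`isCantorian_iff`). A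
transition depends only on which entries of the column coincide, and a pattern with `k` letters
comes from `s.descFactorial k` columns, which gives a recursion with polynomial weights
(`blockedCount_succ_eq_sum_pattern`). To run it in the kernel, sets of states become bits of a
natural number and polynomials become coefficient lists in `t = s - 3`
(`cantorianCount_eq_evalCoeffs`). -/

open Finset

namespace Tableau

/-! ### Equality patterns of columns. -/

section Patterns

variable {n : ℕ} {A : Type*} [DecidableEq A]

/-- The canonical form of a word: each letter is replaced by the first position where it occurs. -/
def pattern (c : Fin n → A) (i : Fin n) : Fin n :=
  (univ.filter fun k => c k = c i).min' ⟨i, by simp⟩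

lemma apply_pattern (c : Fin n → A) (i : Fin n) : c (pattern c i) = c i := by
  have := min'_mem (univ.filter fun k => c k = c i) ⟨i, by simp⟩
  exact (mem_filter.1 this).2

lemma pattern_eq_iff (c : Fin n → A) (i k : Fin n) : pattern c i = pattern c k ↔ c i = c k := by
  constructor
  · intro h
    rw [← apply_pattern c i, h, apply_pattern c k]
  · intro h
    simp only [pattern, h]

lemma pattern_congr {B : Type*} [DecidableEq B] {c : Fin n → A} {d : Fin n → B} :
    pattern c = pattern d ↔ ∀ i k, c i = c k ↔ d i = d k := by
  constructor
  · intro h i k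
    rw [← pattern_eq_iff c, ← pattern_eq_iff d, h]
  · intro h
    funext i
    simp only [pattern, h]

lemma pattern_pattern (c : Fin n → A) : pattern (pattern c) = pattern c :=
  pattern_congr.2 (pattern_eq_iff c)

/-- A canonical `p` is idempotent, so its image indexes the classes of equal entries, and a column
with this pattern is an injective choice of one letter per class. -/
lemma card_pattern_eq [Fintype A] {p : Fin n → Fin n} (hp : pattern p = p) :
    #{c : Fin n → A | pattern c = p} = (Fintype.card A).descFactorial #(univ.image p) := by
  have hpp (i) : p (p i) = p i := by
    conv_lhs => rw [← hp]
    rw [hp]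
    conv_lhs => rw [← congrFun hp i]
    exact apply_pattern p i
  have key (c : Fin n → A) : pattern c = p ↔ ∀ i k, c i = c k ↔ p i = p k := by
    rw [← pattern_congr, hp]
  have e : {c : Fin n → A // pattern c = p} ≃ ((univ.image p : Finset (Fin n)) ↪ A) :=
    { toFun := fun c => ⟨fun x => c.1 x, by
        rintro ⟨x, hx⟩ ⟨y, hy⟩ h
        obtain ⟨i, -, rfl⟩ := mem_image.1 hx
        obtain ⟨k, -, rfl⟩ := mem_image.1 hy
        have := ((key c.1).1 c.2 _ _).1 h
        rw [hpp, hpp] at this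
        exact Subtype.ext this⟩
      invFun := fun e => ⟨fun i => e ⟨p i, mem_image_of_mem p (mem_univ i)⟩, by
        rw [key]
        intro i k
        rw [e.injective.eq_iff, Subtype.mk.injEq]⟩
      left_inv := by
        rintro ⟨c, hc⟩
        ext i
        exact ((key c).1 hc _ _).2 (hpp i)
      right_inv := by
        intro e
        ext ⟨x, hx⟩
        obtain ⟨i, -, rfl⟩ := mem_image.1 hx
        exact congrArg e (Subtype.ext (hpp i)) }
  rw [← Fintype.card_subtype, Fintype.card_congr e, Fintype.card_embedding_eq, Fintype.card_coe]

end Patterns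

/-! ### Column-by-column transfer of states. -/

section Transfer

variable {n : ℕ} {A : Type*}

/-- A state `(i, U)` records that the row-word of index `i` has been matched so far, column by
column, using exactly the rows in `U`. Reading a further column `c` extends it by a new row. -/
def extend (c : Fin n → A) (S : Set (Fin n × Finset (Fin n))) : Set (Fin n × Finset (Fin n)) :=
  {q | ∃ r ∈ S, ∃ k, k ∉ r.2 ∧ c r.1 = c k ∧ q = (r.1, insert k r.2)}

lemma extend_pattern [DecidableEq A] (c : Fin n → A) : extend (pattern c) = extend c := by
  funext S
  simp only [extend, pattern_eq_iff]

/-- The states reached after reading all the columns of `C`. -/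
def reach : (m : ℕ) → (Fin m → Fin n → A) → Set (Fin n × Finset (Fin n)) →
    Set (Fin n × Finset (Fin n))
  | 0, _, S => S
  | m + 1, C, S => reach m (Fin.tail C) (extend (C 0) S)

/-- Each step adds an unused row, so the rows chosen along a surviving path form an injection; for
`m = n` it is a permutation. -/
lemma reach_nonempty_iff (m : ℕ) (C : Fin m → Fin n → A) (S : Set (Fin n × Finset (Fin n))) :
    (reach m C S).Nonempty ↔ ∃ q ∈ S, ∃ f : Fin m → Fin n, Function.Injective f ∧
      ∀ j, f j ∉ q.2 ∧ C j q.1 = C j (f j) := by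
  induction m generalizing S with
  | zero =>
    constructor
    · rintro ⟨q, hq⟩
      exact ⟨q, hq, Fin.elim0, fun i => i.elim0, fun i => i.elim0⟩
    · rintro ⟨q, hq, -⟩
      exact ⟨q, hq⟩
  | succ m ih =>
    rw [reach, ih]
    constructor
    · rintro ⟨-, ⟨r, hr, k, hk, hc, rfl⟩, f, hf, h⟩
      refine ⟨r, hr, Fin.cons k f, ?_, ?_⟩
      · rw [Fin.cons_injective_iff]
        refine ⟨?_, hf⟩
        rintro ⟨j, rfl⟩
        exact (h j).1 (mem_insert_self _ _)
      · intro j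
        refine Fin.cases ⟨hk, hc⟩ (fun j => ⟨?_, (h j).2⟩) j
        exact fun hj => (h j).1 (mem_insert_of_mem hj)
    · rintro ⟨r, hr, f, hf, h⟩
      refine ⟨_, ⟨r, hr, f 0, (h 0).1, (h 0).2, rfl⟩, Fin.tail f, ?_, ?_⟩
      · exact hf.comp (Fin.succ_injective m)
      · intro j
        refine ⟨?_, (h j.succ).2⟩
        rw [mem_insert]
        rintro (hj | hj)
        · exact Fin.succ_ne_zero j (hf hj)
        · exact (h j.succ).1 hj

/-- The states before any column has been read. -/
def initialStates (n : ℕ) : Set (Fin n × Finset (Fin n)) := {q | q.2 = ∅}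

lemma isCantorian_iff (T : Tableau n A) :
    T.IsCantorian ↔ reach n (fun j i => T i j) (initialStates n) = ∅ := by
  rw [← Set.not_nonempty_iff_eq_empty, reach_nonempty_iff, IsCantorian,
    ← Set.not_nonempty_iff_eq_empty, not_iff_not]
  constructor
  · rintro ⟨w, hw, i, rfl⟩
    obtain ⟨π, hπ⟩ := Set.mem_iUnion.1 hw
    exact ⟨(i, ∅), rfl, π, π.injective, fun j => ⟨notMem_empty _, congrFun hπ j⟩⟩
  · rintro ⟨⟨i, U⟩, -, f, hf, h⟩
    refine ⟨fun j => T i j, Set.mem_iUnion.2 ⟨.ofBijective f hf.bijective_of_finite, ?_⟩, i, rfl⟩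
    exact funext fun j => (h j).2

variable (s : ℕ)

open Classical in
/-- The number of sequences of `m` columns which leave no reachable state, starting from `S`. -/
noncomputable def blockedCount (m : ℕ) (S : Set (Fin n × Finset (Fin n))) : ℕ :=
  #{C : Fin m → Fin n → Fin s | reach m C S = ∅}

lemma cantorianCount_eq : cantorianCount n s = blockedCount s n (initialStates n) := by
  classical
  rw [cantorianCount, blockedCount, ← Set.ncard_coe_finset]
  refine Set.ncard_congr (fun T _ j i => T i j) ?_ ?_ ?_
  · intro T hT
    simpa using (isCantorian_iff T).1 hT
  · intro T T' _ _ h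
    ext i j
    exact congrArg Fin.val (congrFun (congrFun h j) i)
  · intro C hC
    refine ⟨fun i j => C j i, (isCantorian_iff _).2 ?_, rfl⟩
    simpa using hC

lemma blockedCount_succ (m : ℕ) (S : Set (Fin n × Finset (Fin n))) :
    blockedCount s (m + 1) S = ∑ c : Fin n → Fin s, blockedCount s m (extend c S) := by
  classical
  simp only [blockedCount, card_filter]
  rw [← (Fin.consEquiv fun _ => Fin n → Fin s).sum_comp, Fintype.sum_prod_type]
  rfl

lemma blockedCount_succ_eq_sum_pattern (m : ℕ) (S : Set (Fin n × Finset (Fin n))) :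
    blockedCount s (m + 1) S = ∑ p : Fin n → Fin n with pattern p = p,
      s.descFactorial #(univ.image p) * blockedCount s m (extend p S) := by
  rw [blockedCount_succ, ← sum_fiberwise_of_maps_to (g := pattern)
    (t := univ.filter fun p : Fin n → Fin n => pattern p = p)
    (fun c _ => by simp [pattern_pattern])]
  refine sum_congr rfl fun p hp => ?_
  rw [mem_filter] at hp
  rw [sum_congr rfl (g := fun _ => blockedCount s m (extend p S)), sum_const, smul_eq_mul,
    card_pattern_eq hp.2, Fintype.card_fin]
  intro c hc
  rw [← (mem_filter.1 hc).2, extend_pattern]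

end Transfer

/-! ### State sets as bit masks. -/

section Encoding

variable {n : ℕ}

/-- The code of a state as a natural number. -/
def code (q : Fin n × Finset (Fin n)) : ℕ := 2 ^ n * q.1 + ∑ k ∈ q.2, 2 ^ (k : ℕ)

lemma code_insert (i : Fin n) {U : Finset (Fin n)} {k : Fin n} (hk : k ∉ U) :
    code (i, insert k U) = code (i, U) + 2 ^ (k : ℕ) := by
  simp only [code, sum_insert hk]
  ring

/-- The bits of `R` are the codes of the states in `S`. -/
def Encodes (R : ℕ) (S : Set (Fin n × Finset (Fin n))) : Prop :=
  ∀ x, R.testBit x = true ↔ ∃ q ∈ S, code q = x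

lemma Encodes.eq_zero_iff {R : ℕ} {S : Set (Fin n × Finset (Fin n))} (h : Encodes R S) :
    R = 0 ↔ S = ∅ := by
  constructor
  · rintro rfl
    refine Set.eq_empty_of_forall_notMem fun q hq => ?_
    simpa using (h (code q)).2 ⟨q, hq, rfl⟩
  · rintro rfl
    refine Nat.eq_of_testBit_eq fun x => ?_
    rw [Nat.zero_testBit, ← Bool.not_eq_true, h]
    simp

/-- Apply to a set of codes the transition given by a list of shifts and masks. -/
def shiftStep (l : List (ℕ × ℕ)) (R : ℕ) : ℕ :=
  l.foldr (fun q acc => Nat.lor (Nat.shiftLeft (Nat.land R q.2) q.1) acc) 0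

lemma testBit_shiftStep (l : List (ℕ × ℕ)) (R x : ℕ) :
    (shiftStep l R).testBit x = true ↔
      ∃ q ∈ l, ∃ y, R.testBit y = true ∧ q.2.testBit y = true ∧ x = y + q.1 := by
  induction l with
  | nil => simp [shiftStep]
  | cons q l ih =>
    have : shiftStep (q :: l) R = ((R &&& q.2) <<< q.1) ||| shiftStep l R := rfl
    rw [this, Nat.testBit_or, Bool.or_eq_true, ih, List.exists_mem_cons_iff]
    refine or_congr_left ?_
    rw [Nat.testBit_shiftLeft, Nat.testBit_and]
    simp only [Bool.and_eq_true, decide_eq_true_eq]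
    constructor
    · rintro ⟨h, h1, h2⟩
      exact ⟨x - q.1, h1, h2, by omega⟩
    · rintro ⟨y, h1, h2, rfl⟩
      simpa using ⟨h1, h2⟩

/-- `q` is the shift and mask by which row `k` extends the states, for a column with pattern `p`. -/
def IsMask (p : Fin n → Fin n) (k : Fin n) (q : ℕ × ℕ) : Prop :=
  q.1 = 2 ^ (k : ℕ) ∧
    ∀ (i : Fin n) (U : Finset (Fin n)), q.2.testBit (code (i, U)) = true ↔ k ∉ U ∧ p i = p k

instance (p : Fin n → Fin n) (k : Fin n) (q : ℕ × ℕ) : Decidable (IsMask p k q) :=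
  inferInstanceAs (Decidable (_ ∧ _))

/-- Adding an unused row `k` to `U` raises the code by `2 ^ k`, so masking out the forbidden states
and shifting by `2 ^ k` treats all states at once. -/
lemma Encodes.shiftStep {R : ℕ} {S : Set (Fin n × Finset (Fin n))} (h : Encodes R S)
    {p : Fin n → Fin n} {l : List (ℕ × ℕ)} (hl : ∀ q ∈ l, ∃ k, IsMask p k q)
    (hl' : ∀ k, ∃ q ∈ l, IsMask p k q) : Encodes (shiftStep l R) (extend p S) := by
  intro x
  rw [testBit_shiftStep]
  constructor
  · rintro ⟨q, hq, y, hR, hy, rfl⟩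
    obtain ⟨k, hk⟩ := hl q hq
    obtain ⟨⟨i, U⟩, hS, rfl⟩ := (h y).1 hR
    obtain ⟨hkU, hp⟩ := (hk.2 i U).1 hy
    exact ⟨(i, insert k U), ⟨_, hS, k, hkU, hp, rfl⟩, by rw [code_insert i hkU, hk.1]⟩
  · rintro ⟨-, ⟨⟨i, U⟩, hS, k, hkU, hp, rfl⟩, rfl⟩
    obtain ⟨q, hq, hk⟩ := hl' k
    exact ⟨q, hq, code (i, U), (h _).2 ⟨_, hS, rfl⟩, (hk.2 i U).2 ⟨hkU, hp⟩,
      by rw [code_insert i hkU, hk.1]⟩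

/-- The code of the set of initial states. -/
def initialCode (n : ℕ) : ℕ :=
  (List.finRange n).foldr (fun (i : Fin n) acc => 2 ^ (2 ^ n * i.1) ||| acc) 0

lemma encodes_initialCode (n : ℕ) : Encodes (initialCode n) (initialStates n) := by
  intro x
  have key (l : List (Fin n)) :
      (l.foldr (fun (i : Fin n) acc => 2 ^ (2 ^ n * i.1) ||| acc) 0).testBit x = true ↔ ∃ i ∈ l, 2 ^ n * i.1 = x := by
    induction l with
    | nil => simp
    | cons i l ih => simp [Nat.testBit_or, Nat.testBit_two_pow, ih]
  rw [initialCode, key]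
  simp [initialStates, code]

end Encoding

/-! ### Polynomials as lists of natural coefficients. -/

section Polynomials

/-- Evaluation of a polynomial given by its list of coefficients, constant term first. -/
def evalCoeffs (l : List ℕ) (t : ℤ) : ℤ := l.foldr (fun a v => a + t * v) 0

@[simp] lemma evalCoeffs_nil (t : ℤ) : evalCoeffs [] t = 0 := rfl

@[simp] lemma evalCoeffs_cons (a : ℕ) (l : List ℕ) (t : ℤ) :
    evalCoeffs (a :: l) t = a + t * evalCoeffs l t := rfl

/-- Sum of polynomials given by their coefficients. -/
def addCoeffs : List ℕ → List ℕ → List ℕ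
  | [], l => l
  | a :: l, [] => a :: l
  | a :: l, b :: l' => (a + b) :: addCoeffs l l'

/-- Product of polynomials given by their coefficients. -/
def mulCoeffs : List ℕ → List ℕ → List ℕ
  | _, [] => []
  | l, b :: l' => addCoeffs (l.map fun a => a * b) (0 :: mulCoeffs l l')

lemma evalCoeffs_add (l l' : List ℕ) (t : ℤ) :
    evalCoeffs (addCoeffs l l') t = evalCoeffs l t + evalCoeffs l' t := by
  induction l, l' using addCoeffs.induct with
  | case1 l => simp [addCoeffs]
  | case2 a l => simp [addCoeffs]
  | case3 a l b l' ih =>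
    simp only [addCoeffs, evalCoeffs_cons, ih]
    push_cast
    ring

lemma evalCoeffs_map_mul (l : List ℕ) (b : ℕ) (t : ℤ) :
    evalCoeffs (l.map fun a => a * b) t = evalCoeffs l t * b := by
  induction l with
  | nil => simp
  | cons a l ih =>
    simp only [List.map_cons, evalCoeffs_cons, ih]
    push_cast
    ring

lemma evalCoeffs_mul (l l' : List ℕ) (t : ℤ) :
    evalCoeffs (mulCoeffs l l') t = evalCoeffs l t * evalCoeffs l' t := by
  induction l' with
  | nil => simp [mulCoeffs]
  | cons b l' ih =>
    simp only [mulCoeffs, evalCoeffs_add, evalCoeffs_map_mul, evalCoeffs_cons, ih]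
    push_cast
    ring

/-- For `k ≤ 4`, the falling factorial of order `k` of `t + 3`, as a polynomial in `t`. The shift
makes the coefficients natural numbers. -/
def fallingCoeffs : ℕ → List ℕ
  | 0 => [1]
  | 1 => [3, 1]
  | 2 => [6, 5, 1]
  | 3 => [6, 11, 6, 1]
  | _ => [0, 6, 11, 6, 1]

lemma evalCoeffs_fallingCoeffs (s : ℕ) {k : ℕ} (hk : k ≤ 4) :
    evalCoeffs (fallingCoeffs k) (s - 3) = s.descFactorial k := by
  rw [← descPochhammer_eval_eq_descFactorial ℤ s k]
  interval_cases k <;> simp [fallingCoeffs, descPochhammer_succ_right] <;> ring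

end Polynomials

/-! ### Computable form of the recursion. -/

section Counting

/-- A column pattern, its number of letters, and its transition in terms of shifts and masks. -/
abbrev PatternEntry (n : ℕ) : Type := (Fin n → Fin n) × ℕ × List (ℕ × ℕ)

variable {n : ℕ}

/-- The data of an entry are consistent. -/
def PatternEntry.IsValid (e : PatternEntry n) : Prop :=
  e.2.1 = #(univ.image e.1) ∧ (∀ q ∈ e.2.2, ∃ k, IsMask e.1 k q) ∧
    ∀ k, ∃ q ∈ e.2.2, IsMask e.1 k q

instance (e : PatternEntry n) : Decidable e.IsValid := inferInstanceAs (Decidable (_ ∧ _))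

/-- Application of `f` to `R`, written so that `R` is evaluated first. -/
def evalFirst {α : Type*} (R : ℕ) (f : ℕ → α) : α :=
  match R with
  | 0 => f 0
  | r + 1 => f (r + 1)

lemma evalFirst_eq {α : Type*} (R : ℕ) (f : ℕ → α) : evalFirst R f = f R := by
  cases R <;> rfl

/-- The coefficients of the polynomial counting the sequences of `m` columns that leave no
reachable state, starting from the states encoded by `R`. -/
def countCoeffs (tbl : List (PatternEntry n)) : ℕ → ℕ → List ℕ
  | 0, 0 => [1]
  | 0, _ + 1 => []
  | m + 1, R => tbl.foldr (fun e acc =>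
      addCoeffs (mulCoeffs (fallingCoeffs e.2.1)
        (evalFirst (shiftStep e.2.2 R) (countCoeffs tbl m))) acc) []

lemma blockedCount_eq_evalCoeffs (hn : n ≤ 4) {tbl : List (PatternEntry n)}
    (hnodup : (tbl.map Prod.fst).Nodup)
    (hcanon : (tbl.map Prod.fst).toFinset = univ.filter fun p => pattern p = p)
    (hvalid : ∀ e ∈ tbl, e.IsValid) (s m : ℕ) {R : ℕ} {S : Set (Fin n × Finset (Fin n))}
    (h : Encodes R S) :
    (blockedCount s m S : ℤ) = evalCoeffs (countCoeffs tbl m R) (s - 3) := by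
  induction m generalizing R S with
  | zero =>
    classical
    rw [blockedCount, card_filter]
    simp only [reach, ← h.eq_zero_iff]
    cases R <;> simp [countCoeffs]
  | succ m ih =>
    have key (l : List (PatternEntry n)) (hl : l ⊆ tbl) :
        (((l.map fun e => s.descFactorial #(univ.image e.1) *
          blockedCount s m (extend e.1 S)).sum : ℕ) : ℤ) =
        evalCoeffs (l.foldr (fun e acc => addCoeffs (mulCoeffs (fallingCoeffs e.2.1)
          (countCoeffs tbl m (shiftStep e.2.2 R))) acc) []) (s - 3) := by
      induction l with
      | nil => simp
      | cons e l ihl =>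
        obtain ⟨he, hl⟩ := List.cons_subset.1 hl
        obtain ⟨hcard, hmask, hmask'⟩ := hvalid e he
        have hle : e.2.1 ≤ 4 := hcard ▸ (card_le_univ _).trans (by simpa using hn)
        rw [List.map_cons, List.sum_cons, List.foldr_cons, evalCoeffs_add, evalCoeffs_mul,
          evalCoeffs_fallingCoeffs s hle, ← ihl hl, ← ih (h.shiftStep hmask hmask'), hcard]
        push_cast
        rfl
    rw [blockedCount_succ_eq_sum_pattern, ← hcanon, List.sum_toFinset _ hnodup, List.map_map,
      countCoeffs]
    simp only [evalFirst_eq]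
    rw [← key tbl (List.Subset.refl _)]
    rfl

lemma cantorianCount_eq_evalCoeffs (hn : n ≤ 4) {tbl : List (PatternEntry n)}
    (hnodup : (tbl.map Prod.fst).Nodup)
    (hcanon : (tbl.map Prod.fst).toFinset = univ.filter fun p => pattern p = p)
    (hvalid : ∀ e ∈ tbl, e.IsValid) (s : ℕ) :
    (cantorianCount n s : ℤ) = evalCoeffs (countCoeffs tbl n (initialCode n)) (s - 3) := by
  rw [cantorianCount_eq]
  exact blockedCount_eq_evalCoeffs hn hnodup hcanon hvalid s n (encodes_initialCode n)

end Counting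

/-! ### Explicit tables and kernel evaluation. -/

section Tables

/-- Canonical column patterns of length `2`, with their numbers of letters and transition masks. -/
def patternTable2 : List (PatternEntry 2) :=
  [(![0, 0], 1,
    [(1, 85), (2, 51)]),
   (![0, 1], 2,
    [(1, 5), (2, 48)])]

/-- Canonical column patterns of length `3`, with their numbers of letters and transition masks. -/
def patternTable3 : List (PatternEntry 3) :=
  [(![0, 0, 0], 1,
    [(1, 5592405), (2, 3355443), (4, 986895)]),
   (![0, 0, 2], 2,
    [(1, 21845), (2, 13107), (4, 983040)]),
   (![0, 1, 0], 2,
    [(1, 5570645), (2, 13056), (4, 983055)]),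
   (![0, 1, 1], 2,
    [(1, 85), (2, 3355392), (4, 986880)]),
   (![0, 1, 2], 3,
    [(1, 85), (2, 13056), (4, 983040)])]

/-- Canonical column patterns of length `4`, with their numbers of letters and transition masks. -/
def patternTable4 : List (PatternEntry 4) :=
  [(![0, 0, 0, 0], 1,
    [(1, 6148914691236517205), (2, 3689348814741910323),
     (4, 1085102592571150095), (8, 71777214294589695)]),
   (![0, 0, 0, 3], 2,
    [(1, 93824992236885), (2, 56294995342131),
     (4, 16557351571215), (8, 71776119061217280)]),
   (![0, 0, 2, 0], 2,
    [(1, 6148820867675936085), (2, 3689292520605561651),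
     (4, 16557098926080), (8, 71776119077929215)]),
   (![0, 0, 2, 2], 2,
    [(1, 1431655765), (2, 858993459),
     (4, 1085102592318504960), (8, 71777214277877760)]),
   (![0, 1, 0, 0], 2,
    [(1, 6148914689804883285), (2, 858980352),
     (4, 1085102592318508815), (8, 71777214277878015)]),
   (![0, 1, 0, 1], 2,
    [(1, 93823560602965), (2, 3689292520605548544),
     (4, 16557098929935), (8, 71776119077928960)]),
   (![0, 1, 1, 0], 2,
    [(1, 6148820866244302165), (2, 56294995329024),
     (4, 16557351567360), (8, 71776119061217535)]),
   (![0, 1, 1, 1], 2,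
    [(1, 21845), (2, 3689348814741897216),
     (4, 1085102592571146240), (8, 71777214294589440)]),
   (![0, 0, 2, 3], 3,
    [(1, 1431655765), (2, 858993459),
     (4, 16557098926080), (8, 71776119061217280)]),
   (![0, 1, 0, 3], 3,
    [(1, 93823560602965), (2, 858980352),
     (4, 16557098929935), (8, 71776119061217280)]),
   (![0, 1, 1, 3], 3,
    [(1, 21845), (2, 56294995329024),
     (4, 16557351567360), (8, 71776119061217280)]),
   (![0, 1, 2, 0], 3,
    [(1, 6148820866244302165), (2, 858980352),
     (4, 16557098926080), (8, 71776119061217535)]),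
   (![0, 1, 2, 1], 3,
    [(1, 21845), (2, 3689292520605548544),
     (4, 16557098926080), (8, 71776119077928960)]),
   (![0, 1, 2, 2], 3,
    [(1, 21845), (2, 858980352),
     (4, 1085102592318504960), (8, 71777214277877760)]),
   (![0, 1, 2, 3], 4,
    [(1, 21845), (2, 858980352),
     (4, 16557098926080), (8, 71776119061217280)])]

lemma countCoeffs_patternTable2 : countCoeffs patternTable2 2 (initialCode 2) =
    [36, 60, 37, 10, 1] := by
  decide +kernel

lemma countCoeffs_patternTable3 : countCoeffs patternTable3 3 (initialCode 3) =
    [5076, 19656, 33201, 32021, 19386, 7620, 1938, 306, 27, 1] := by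
  decide +kernel

lemma countCoeffs_patternTable4 : countCoeffs patternTable4 4 (initialCode 4) =
    [8111664, 53571888, 164758104, 312383964, 407620315, 387191148, 276333390, 150864616, 63581874,
      20734392, 5212800, 1000224, 143820, 15024, 1080, 48, 1] := by
  decide +kernel

end Tables

end Tableau

open Tableau in
theorem proposition4p5 (s : ℕ) :
    (cantorianCount 2 s : ℤ) = (s : ℤ) ^ 2 * ((s : ℤ) - 1) ^ 2 ∧
    (cantorianCount 3 s : ℤ) =
      (s : ℤ) ^ 3 * ((s : ℤ) - 1) ^ 2 *
        ((s : ℤ) ^ 4 + 2 * (s : ℤ) ^ 3 - 15 * (s : ℤ) ^ 2 + 16 * (s : ℤ) - 1) ∧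
    (cantorianCount 4 s : ℤ) =
      (s : ℤ) ^ 4 * ((s : ℤ) - 1) ^ 2 *
        ((s : ℤ) ^ 10 + 2 * (s : ℤ) ^ 9 + 3 * (s : ℤ) ^ 8 - 92 * (s : ℤ) ^ 7
          - 43 * (s : ℤ) ^ 6 + 1014 * (s : ℤ) ^ 5 - 449 * (s : ℤ) ^ 4
          - 5680 * (s : ℤ) ^ 3 + 12045 * (s : ℤ) ^ 2 - 9406 * (s : ℤ) + 2629) := by
  refine ⟨?_, ?_, ?_⟩
  -- The decision calls check that the table lists every canonical pattern once, with correct letter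
  -- counts and masks.
  · rw [cantorianCount_eq_evalCoeffs (by decide) (tbl := patternTable2) (by decide +kernel)
      (by decide +kernel) (by decide +kernel), countCoeffs_patternTable2]
    simp only [evalCoeffs_cons, evalCoeffs_nil]
    push_cast
    ring
  · rw [cantorianCount_eq_evalCoeffs (by decide) (tbl := patternTable3) (by decide +kernel)
      (by decide +kernel) (by decide +kernel), countCoeffs_patternTable3]
    simp only [evalCoeffs_cons, evalCoeffs_nil]
    push_cast
    ring
  · rw [cantorianCount_eq_evalCoeffs (by decide) (tbl := patternTable4) (by decide +kernel)
      (by decide +kernel) (by decide +kernel), countCoeffs_patternTable4]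
    simp only [evalCoeffs_cons, evalCoeffs_nil]
    push_cast
    ring
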